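/- Let $M$ be a smooth (Hausdorff) manifold of dimension $n$, let $A^k(M)=\Gamma(\wedge^kTM)$ be the space of smooth $k$-vector fields ($A^0(M)=C^\infty(M)$, $A^{-1}(M)=0$), let $\mathcal A(M)=\bigoplus_k A^k(M)$, and let $[\cdot,\cdot]:A^k(M)\times A^l(M)\to A^{k+l-1}(M)$ be the Schouten–Nijenhuis bracket, normalised so that $[V,Q]=L_VQ$ for $V\in A^1(M)$, $[P,Q]=-(-1)^{(p-1)(q-1)}[Q,P]$ and $[P,Q\wedge R]=[P,Q]\wedge R+(-1)^{(p-1)q}Q\wedge[P,R]$ for $P\in A^p(M)$, $Q\in A^q(M)$, $R\in\mathcal A(M)$. A higher connection on $M$ is a map $\nabla:\mathcal A(M)\times\mathcal A(M)\to\mathcal A(M)$ such that: $\nabla_XY\in A^{k+l-1}(M)$ for $X\in A^k(M)$, $Y\in A^l(M)$; $\nabla_{fX+X'}Y=f\nabla_XY+\nabla_{X'}Y$ and $\nabla_X(Y+Y')=\nabla_XY+\nabla_XY'$ for $f\in C^\infty(M)$ and $X,X',Y,Y'\in\mathcal A(M)$; $\nabla_Xf=[X,f]$ and $\nabla_X(fY)=[X,f]\wedge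 Y+f\nabla_XY$ for $X\in A^k(M)$, $f\in C^\infty(M)$, $Y\in\mathcal A(M)$; and $\nabla_fX=0$ for $f\in C^\infty(M)$, $X\in\mathcal A(M)$. Its higher torsion is $$T(X,Y)=\nabla_XY-(-1)^{(k-1)(l-1)}\nabla_YX-[X,Y]\qquad (X\in A^k(M),\ Y\in A^l(M)),$$ and $\nabla$ is torsion-free if $T\equiv0$. The restriction of $\nabla$ to $A^1(M)\times A^1(M)$ is an affine connection $\widetilde\nabla$ on $TM$. Extend it to $\mathcal A(M)\times\mathcal A(M)$ by letting $\widetilde\nabla_V$, for a vector field $V$, act on $\mathcal A(M)$ as a derivation of the wedge product with $\widetilde\nabla_Vf=Vf$, by setting $$\widetilde\nabla_{X_1\wedge\cdots\wedge X_k}Y=\sum_{j=1}^k(-1)^{k-j}X_1\wedge\cdots\wedge\widehat{X_j}\wedge\cdots\wedge X_k\wedge\widetilde\nabla_{X_j}Y$$ for vector fields $X_1,\dots,X_k$ ($k\ge1$), extended $C^\infty(M)$-linearly, and by setting $\widetilde\nabla_f=0$ for functions $f$. The twist fields of $\nabla$ are $F^{k,l}(X,Y)=\nabla_XY-\widetilde\nabla_XY$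 for $X\in A^k(M)$, $Y\in A^l(M)$. Theorem. A higher connection $\nabla$ is torsion-free if and only if (i) the affine connection $\widetilde\nabla$ is torsion-free, i.e. $\widetilde\nabla_VW-\widetilde\nabla_WV=[V,W]$ for all vector fields $V,W$; and (ii) $F^{k,l}(X,Y)=(-1)^{(k-1)(l-1)}F^{l,k}(Y,X)$ for all $k,l\ge0$, $X\in A^k(M)$, $Y\in A^l(M)$. -/

import Mathlib

open Bundle Manifold
open scoped ContDiff Topology

noncomputable section

namespace HigherConn

/-! ### Linear algebra in the model space `ℝⁿ` -/

/-- The standard basis `e₀, …, eₙ₋₁` of `ℝⁿ`. -/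
def stdBasis (n : ℕ) : Module.Basis (Fin n) ℝ (EuclideanSpace ℝ (Fin n)) :=
  (EuclideanSpace.basisFun (Fin n) ℝ).toBasis

/-- The dual basis `dxⁱ`. -/
def dx {n : ℕ} (i : Fin n) : Module.Dual ℝ (EuclideanSpace ℝ (Fin n)) :=
  (stdBasis n).coord i

/-- The basis of `⋀ ℝⁿ` consisting of the wedge products of standard basis vectors. -/
def wedgeBasis (n : ℕ) :
    Module.Basis (Finset (Fin n)) ℝ (ExteriorAlgebra ℝ (EuclideanSpace ℝ (Fin n))) :=
  (stdBasis n).ExteriorAlgebra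

/-- The interior product `α ⌋ x` from the left:
`α ⌋ (v₁ ∧ ⋯ ∧ vₖ) = ∑ⱼ (-1)^(j-1) α(vⱼ) v₁ ∧ ⋯ v̂ⱼ ⋯ ∧ vₖ`. -/
def contrL {n : ℕ} (α : Module.Dual ℝ (EuclideanSpace ℝ (Fin n)))
    (x : ExteriorAlgebra ℝ (EuclideanSpace ℝ (Fin n))) :
    ExteriorAlgebra ℝ (EuclideanSpace ℝ (Fin n)) :=
  CliffordAlgebra.contractLeft α x

/-- The interior product `x ⌊ α` from the right:
`(v₁ ∧ ⋯ ∧ vₖ) ⌊ α = ∑ⱼ (-1)^(k-j) α(vⱼ) v₁ ∧ ⋯ v̂ⱼ ⋯ ∧ vₖ`;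
on `k`-vectors it equals `(-1)^(k-1) α ⌋ x`. -/
def contrR {n : ℕ} (x : ExteriorAlgebra ℝ (EuclideanSpace ℝ (Fin n)))
    (α : Module.Dual ℝ (EuclideanSpace ℝ (Fin n))) :
    ExteriorAlgebra ℝ (EuclideanSpace ℝ (Fin n)) :=
  CliffordAlgebra.contractRight x α

/-- The partial derivative `∂ᵢ f (u)` of a function `f : ℝⁿ → ⋀ ℝⁿ`, taken componentwise. -/
def pderiv {n : ℕ} (i : Fin n)
    (f : EuclideanSpace ℝ (Fin n) → ExteriorAlgebra ℝ (EuclideanSpace ℝ (Fin n)))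
    (u : EuclideanSpace ℝ (Fin n)) : ExteriorAlgebra ℝ (EuclideanSpace ℝ (Fin n)) :=
  ∑ J : Finset (Fin n),
    (fderiv ℝ (fun w => (wedgeBasis n).repr (f w) J) u (stdBasis n i)) • wedgeBasis n J

/-! ### Multivector fields -/

section Fields

variable (n : ℕ) (M : Type*) [TopologicalSpace M] [ChartedSpace (EuclideanSpace ℝ (Fin n)) M]
  [IsManifold (𝓡 n) ∞ M]

/-- Smooth real functions on `M`. -/
abbrev Fn := C^∞⟮𝓡 n, M; 𝓘(ℝ, ℝ), ℝ⟯

/-- Smooth vector fields on `M`, i.e. smooth sections of `TM`. -/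
abbrev VF := Cₛ^∞⟮𝓡 n; EuclideanSpace ℝ (Fin n), fun p : M => TangentSpace (𝓡 n) p⟯

variable {n M}

/-- The trivialisation of `TM` over the preferred chart at `p`, at the point `q`:
the differential of that chart, `T_q M → ℝⁿ`. -/
def triv (p q : M) : TangentSpace (𝓡 n) q →ₗ[ℝ] EuclideanSpace ℝ (Fin n) :=
  ((trivializationAt (EuclideanSpace ℝ (Fin n)) (TangentSpace (𝓡 n)) p).continuousLinearMapAt ℝ q :
    TangentSpace (𝓡 n) q →L[ℝ] EuclideanSpace ℝ (Fin n))

/-- The inverse `ℝⁿ → T_q M` of `triv p q` (for `q` in the domain of the chart at `p`). -/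
def trivSymm (p q : M) : EuclideanSpace ℝ (Fin n) →ₗ[ℝ] TangentSpace (𝓡 n) q :=
  ((trivializationAt (EuclideanSpace ℝ (Fin n)) (TangentSpace (𝓡 n)) p).symmL ℝ q :
    EuclideanSpace ℝ (Fin n) →L[ℝ] TangentSpace (𝓡 n) q)

/-- A not necessarily continuous section of `⋀ TM` is smooth if, in the trivialisation of `⋀ TM`
induced by the trivialisation of `TM` over any preferred chart, its components are smooth. -/
def IsSmoothMV (X : (p : M) → ExteriorAlgebra ℝ (TangentSpace (𝓡 n) p)) : Prop :=
  ∀ (p : M) (J : Finset (Fin n)),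
    ContMDiffAt (𝓡 n) 𝓘(ℝ, ℝ) ∞
      (fun q => (wedgeBasis n).repr (ExteriorAlgebra.map (triv p q) (X q)) J) p

variable (n M)

/-- `𝒜(M)`: the space of smooth sections of `⋀ TM = ⨁ₖ ⋀ᵏ TM`. -/
def MVF : Submodule ℝ ((p : M) → ExteriorAlgebra ℝ (TangentSpace (𝓡 n) p)) where
  carrier := {X | IsSmoothMV X}
  zero_mem' := fun p J => by
    simp only [Pi.zero_apply, map_zero, Finsupp.coe_zero]
    exact contMDiffAt_const
  add_mem' := fun {X Y} hX hY p J => by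
    simp only [Pi.add_apply, map_add, Finsupp.coe_add]
    exact (hX p J).add (hY p J)
  smul_mem' := fun c X hX p J => by
    simp only [Pi.smul_apply, map_smul, Finsupp.coe_smul]
    exact (contMDiffAt_const (I := 𝓡 n) (I' := 𝓘(ℝ, ℝ)) (c := c)).smul (hX p J)

variable {n M}

/-- The product `f X` of a smooth function and a multivector field. -/
instance : SMul (Fn n M) (MVF n M) where
  smul f X := ⟨fun p => f p • X.1 p, fun p J => by
    simp only [map_smul, Finsupp.coe_smul, Pi.smul_apply]
    exact (f.contMDiff p).smul (X.2 p J)⟩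

/-- `X ∈ Aᵏ(M)`: the multivector field `X` is a `k`-vector field. -/
def IsHom (k : ℕ) (X : MVF n M) : Prop :=
  ∀ p, X.1 p ∈ ⋀[ℝ]^k (TangentSpace (𝓡 n) p)

/-- A smooth function as an element of `A⁰(M)`. -/
def ofFn (f : Fn n M) : MVF n M :=
  ⟨fun p => algebraMap ℝ _ (f p), fun p J => by
    simp only [Algebra.algebraMap_eq_smul_one, map_smul, map_one, Finsupp.coe_smul, Pi.smul_apply]
    exact (f.contMDiff p).smul contMDiffAt_const⟩

lemma contMDiffAt_triv (V : VF n M) (p : M) :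
    ContMDiffAt (𝓡 n) 𝓘(ℝ, EuclideanSpace ℝ (Fin n)) ∞ (fun q => triv p q (V q)) p := by
  have h := (contMDiffAt_section (IB := 𝓡 n) (F := EuclideanSpace ℝ (Fin n))
    (E := fun p : M => TangentSpace (𝓡 n) p) (s := fun q => V q) p).1 (V.contMDiff p)
  refine h.congr_of_eventuallyEq ?_
  filter_upwards [(trivializationAt (EuclideanSpace ℝ (Fin n))
    (TangentSpace (𝓡 n) : M → Type _) p).open_baseSet.mem_nhds
    (FiberBundle.mem_baseSet_trivializationAt' p)] with q hq
  have hq' : q ∈ (chartAt (EuclideanSpace ℝ (Fin n)) p).source := hq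
  simp [triv, Trivialization.linearMapAt_apply, hq']

/-- A vector field as an element of `A¹(M)`. -/
def ofVF (V : VF n M) : MVF n M :=
  ⟨fun p => ExteriorAlgebra.ι ℝ (V p), fun p J => by
    simp only [ExteriorAlgebra.map_apply_ι]
    have h := contMDiffAt_triv V p
    let L : EuclideanSpace ℝ (Fin n) →L[ℝ] ℝ :=
      (((wedgeBasis n).coord J) ∘ₗ (ExteriorAlgebra.ι ℝ)).toContinuousLinearMap
    exact L.contMDiff.contMDiffAt.comp p h⟩

/-- The degree-one part of a multivector field, as a vector field; inverse to `ofVF` on `A¹(M)`. -/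
def toVF (X : MVF n M) : VF n M :=
  ⟨fun p => ExteriorAlgebra.ιInv (X.1 p), fun p => by
    rw [contMDiffAt_section]
    have hX : ∀ J, ContMDiffAt (𝓡 n) 𝓘(ℝ, ℝ) ∞ (fun q =>
      (wedgeBasis n).repr (ExteriorAlgebra.map (triv p q) (X.1 q)) J) p := X.2 p
    have h : ContMDiffAt (𝓡 n) 𝓘(ℝ, EuclideanSpace ℝ (Fin n)) ∞ (fun q => ∑ J : Finset (Fin n),
        (wedgeBasis n).repr (ExteriorAlgebra.map (triv p q) (X.1 q)) J •
          (ExteriorAlgebra.ιInv (wedgeBasis n J) : EuclideanSpace ℝ (Fin n))) p :=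
      contMDiffAt_finsetSum fun J _ => (hX J).smul contMDiffAt_const
    refine h.congr_of_eventuallyEq ?_
    filter_upwards [(trivializationAt (EuclideanSpace ℝ (Fin n))
      (TangentSpace (𝓡 n) : M → Type _) p).open_baseSet.mem_nhds
      (FiberBundle.mem_baseSet_trivializationAt' p)] with q hq
    have h1 : (∑ J : Finset (Fin n),
        (wedgeBasis n).repr (ExteriorAlgebra.map (triv p q) (X.1 q)) J •
          (ExteriorAlgebra.ιInv (wedgeBasis n J) : EuclideanSpace ℝ (Fin n)))
        = ExteriorAlgebra.ιInv (ExteriorAlgebra.map (triv p q) (X.1 q)) := by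
      conv_rhs => rw [← (wedgeBasis n).sum_repr (ExteriorAlgebra.map (triv p q) (X.1 q))]
      simp only [map_sum, map_smul]
    have h2 := LinearMap.congr_fun (ExteriorAlgebra.ιInv_comp_map (triv (n := n) p q)) (X.1 q)
    simp only [LinearMap.comp_apply, AlgHom.toLinearMap_apply] at h2
    rw [h1, h2]
    have hq' : q ∈ (chartAt (EuclideanSpace ℝ (Fin n)) p).source := hq
    simp [triv, Trivialization.linearMapAt_apply, hq']⟩

/-- The product `f V` of a smooth function and a vector field. -/
instance : SMul (Fn n M) (VF n M) where
  smul f V := ⟨fun p => f p • V p, f.contMDiff.smul_section V.contMDiff⟩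

/-- The representation of a section of `⋀ TM` in the preferred chart at `p`,
as a function `ℝⁿ → ⋀ ℝⁿ`. -/
def localRep (p : M) (X : (q : M) → ExteriorAlgebra ℝ (TangentSpace (𝓡 n) q))
    (u : EuclideanSpace ℝ (Fin n)) : ExteriorAlgebra ℝ (EuclideanSpace ℝ (Fin n)) :=
  ExteriorAlgebra.map (triv p ((extChartAt (𝓡 n) p).symm u)) (X ((extChartAt (𝓡 n) p).symm u))

/-- The Schouten–Nijenhuis bracket, given in local coordinates by
`[X, Y] = ∑ᵢ (X ⌊ dxⁱ) ∧ ∂ᵢY - ∂ᵢX ∧ (dxⁱ ⌋ Y)`.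
Its value at `p` is computed in the preferred chart at `p`. In particular `[X, f] = (-1)^(k-1) i_f X`
for a `k`-vector field `X` and a function `f`, and `[V, W]` is the Lie bracket of vector fields
for `V, W ∈ A¹(M)`. -/
def schouten (X Y : MVF n M) (p : M) : ExteriorAlgebra ℝ (TangentSpace (𝓡 n) p) :=
  let u := extChartAt (𝓡 n) p p
  let x := localRep p X.1
  let y := localRep p Y.1
  ExteriorAlgebra.map (trivSymm p p)
    (∑ i : Fin n, (contrR (x u) (dx i) * pderiv i y u - pderiv i x u * contrL (dx i) (y u)))

end Fields

/-! ### Affine connections and their extension to multivector fields -/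

section Affine

variable (n : ℕ) (M : Type*) [TopologicalSpace M] [ChartedSpace (EuclideanSpace ℝ (Fin n)) M]
  [IsManifold (𝓡 n) ∞ M]

/-- An affine connection on `TM`; `D V W` stands for `∇_V W`. -/
structure AffineConnection where
  toFun : VF n M → VF n M → VF n M
  add_left : ∀ V V' W, toFun (V + V') W = toFun V W + toFun V' W
  smul_left : ∀ (f : Fn n M) V W, toFun (f • V) W = f • toFun V W
  add_right : ∀ V W W', toFun V (W + W') = toFun V W + toFun V W'
  leibniz : ∀ V (f : Fn n M) W p,
    toFun V (f • W) p = mvfderiv (𝓡 n) f p (V p) • W p + f p • toFun V W p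

variable {n M}

/-- `D` is torsion-free: `D_V W - D_W V = [V, W]` (Lie bracket) for all vector fields `V, W`. -/
def AffineConnection.TorsionFree (D : AffineConnection n M) : Prop :=
  ∀ (V W : VF n M) (p : M),
    D.toFun V W p - D.toFun W V p - VectorField.mlieBracket (𝓡 n) (⇑V) (⇑W) p = 0

variable [T2Space M]

/-- A global vector field which, near `p`, is the `i`-th coordinate vector field of the preferred
chart at `p`. -/
def coordVF (p : M) (i : Fin n) : VF n M :=
  ⟨(Classical.arbitrary (SmoothBumpFunction (𝓡 n) p) : M → ℝ) • (fun q => trivSymm p q (stdBasis n i)), by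
    refine ContMDiffOn.smul_section_of_tsupport (u := (chartAt (EuclideanSpace ℝ (Fin n)) p).source)
      (SmoothBumpFunction.contMDiff _).contMDiffOn (chartAt _ p).open_source
      (SmoothBumpFunction.tsupport_subset_chartAt_source _) ?_
    intro q hq
    have hq' : q ∈ (trivializationAt (EuclideanSpace ℝ (Fin n))
      (TangentSpace (𝓡 n) : M → Type _) p).baseSet := hq
    rw [Trivialization.contMDiffWithinAt_section _ hq']
    refine (contMDiffWithinAt_const (c := stdBasis n i)).congr_of_mem (fun r hr => ?_) hq
    have hr' : r ∈ (trivializationAt (EuclideanSpace ℝ (Fin n))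
      (TangentSpace (𝓡 n) : M → Type _) p).baseSet := hr
    have e : trivSymm p r (stdBasis n i) = (trivializationAt (EuclideanSpace ℝ (Fin n))
        (TangentSpace (𝓡 n) : M → Type _) p).symm r (stdBasis n i) := by
      simp only [trivSymm, Trivialization.symmL]
      exact congrFun (Trivialization.coe_symmₗ (R := ℝ) _ hr') _
    rw [e]
    exact congrArg Prod.snd ((trivializationAt (EuclideanSpace ℝ (Fin n))
      (TangentSpace (𝓡 n) : M → Type _) p).apply_mk_symm hr' (stdBasis n i))⟩

/-- The vector `Γᵢⱼ = (∇_{∂ᵢ} ∂ⱼ)(p)` of Christoffel symbols in the preferred chart at `p`. -/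
def christoffel (D : AffineConnection n M) (p : M) (i j : Fin n) : EuclideanSpace ℝ (Fin n) :=
  triv p p (D.toFun (coordVF p i) (coordVF p j) p)

/-- The coordinates of `(D_{∂ᵢ} Y)(p)`, where `D_{∂ᵢ}` is the extension of the affine connection
to `⋀ TM` as a derivation of the wedge product: `∂ᵢY + ∑ⱼ Γᵢⱼ ∧ (dxʲ ⌋ Y)`. -/
def covDeriv (D : AffineConnection n M) (Y : MVF n M) (p : M) (i : Fin n) :
    ExteriorAlgebra ℝ (EuclideanSpace ℝ (Fin n)) :=
  let u := extChartAt (𝓡 n) p p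
  let y := localRep p Y.1
  pderiv i y u + ∑ j : Fin n, ExteriorAlgebra.ι ℝ (christoffel D p i j) * contrL (dx j) (y u)

/-- The extension `D_X Y` of an affine connection to multivector fields: the map determined by
`D_X Y = ∑ⱼ (-1)^(k-j) X₁ ∧ ⋯ X̂ⱼ ⋯ ∧ Xₖ ∧ D_{Xⱼ} Y` for `X = X₁ ∧ ⋯ ∧ Xₖ`, that is
`D_X Y = ∑ᵢ (X ⌊ dxⁱ) ∧ D_{∂ᵢ} Y`. -/
def AffineConnection.induced (D : AffineConnection n M) (X Y : MVF n M) (p : M) :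
    ExteriorAlgebra ℝ (TangentSpace (𝓡 n) p) :=
  let u := extChartAt (𝓡 n) p p
  ExteriorAlgebra.map (trivSymm p p)
    (∑ i : Fin n, contrR (localRep p X.1 u) (dx i) * covDeriv D Y p i)

end Affine

/-! ### Higher connections -/

section Higher

variable (n : ℕ) (M : Type*) [TopologicalSpace M] [ChartedSpace (EuclideanSpace ℝ (Fin n)) M]
  [IsManifold (𝓡 n) ∞ M]

/-- A higher affine connection `(X, Y) ↦ ∇_X Y` on `M`. In the field `degree`, the case
`k = l = 0` (where `∇_X Y ∈ A⁻¹(M) = 0`) is covered by `fn_left`. -/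
structure HigherConnection where
  toFun : MVF n M → MVF n M → MVF n M
  degree : ∀ (k l m : ℕ) (X Y : MVF n M), k + l = m + 1 → IsHom k X → IsHom l Y →
    IsHom m (toFun X Y)
  linear_left : ∀ (f : Fn n M) (X X' Y : MVF n M),
    toFun (f • X + X') Y = f • toFun X Y + toFun X' Y
  add_right : ∀ X Y Y' : MVF n M, toFun X (Y + Y') = toFun X Y + toFun X Y'
  apply_fn : ∀ (k : ℕ) (X : MVF n M) (f : Fn n M), IsHom k X →
    ∀ p, (toFun X (ofFn f)).1 p = schouten X (ofFn f) p
  leibniz : ∀ (k : ℕ) (X : MVF n M) (f : Fn n M) (Y : MVF n M), IsHom k X →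
    ∀ p, (toFun X (f • Y)).1 p = schouten X (ofFn f) p * Y.1 p + f p • (toFun X Y).1 p
  fn_left : ∀ (f : Fn n M) (X : MVF n M), toFun (ofFn f) X = 0

variable {n M}

/-- The sign `(-1)^((k-1)(l-1))`. -/
def sgn (k l : ℕ) : ℝ := (-1 : ℝ) ^ (((k : ℤ) - 1) * ((l : ℤ) - 1))

/-- The higher torsion `T(X, Y) = ∇_X Y - (-1)^((k-1)(l-1)) ∇_Y X - [X, Y]` for `X ∈ Aᵏ(M)`,
`Y ∈ Aˡ(M)`. -/
def HigherConnection.torsion (C : HigherConnection n M) (k l : ℕ) (X Y : MVF n M) (p : M) :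
    ExteriorAlgebra ℝ (TangentSpace (𝓡 n) p) :=
  (C.toFun X Y).1 p - sgn k l • (C.toFun Y X).1 p - schouten X Y p

/-- A higher connection is torsion-free if its higher torsion vanishes identically. -/
def HigherConnection.TorsionFree (C : HigherConnection n M) : Prop :=
  ∀ (k l : ℕ) (X Y : MVF n M), IsHom k X → IsHom l Y → ∀ p, C.torsion k l X Y p = 0

lemma isHom_ofVF (V : VF n M) : IsHom 1 (ofVF V) := fun p => by
  simp [ofVF]

lemma ofVF_add (V W : VF n M) : ofVF (V + W) = ofVF V + ofVF W :=
  Subtype.ext (funext fun p => map_add (ExteriorAlgebra.ι ℝ) (V p) (W p))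

lemma ofVF_smul (f : Fn n M) (V : VF n M) : ofVF (f • V) = f • ofVF V :=
  Subtype.ext (funext fun p => map_smul (ExteriorAlgebra.ι ℝ) (f p) (V p))

lemma toVF_add (X Y : MVF n M) : toVF (X + Y) = toVF X + toVF Y :=
  ContMDiffSection.ext fun p => map_add ExteriorAlgebra.ιInv (X.1 p) (Y.1 p)

lemma toVF_smul (f : Fn n M) (X : MVF n M) : toVF (f • X) = f • toVF X :=
  ContMDiffSection.ext fun p => map_smul ExteriorAlgebra.ιInv (f p) (X.1 p)

lemma pderiv_algebraMap {i : Fin n} {g : EuclideanSpace ℝ (Fin n) → ℝ}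
    {u : EuclideanSpace ℝ (Fin n)} (hg : DifferentiableAt ℝ g u) :
    pderiv i (fun w => algebraMap ℝ _ (g w)) u = algebraMap ℝ _ (fderiv ℝ g u (stdBasis n i)) := by
  have h : ∀ J, fderiv ℝ (fun w => (wedgeBasis n).repr (algebraMap ℝ _ (g w)) J) u (stdBasis n i)
      = fderiv ℝ g u (stdBasis n i) * (wedgeBasis n).repr 1 J := fun J => by
    simp only [Algebra.algebraMap_eq_smul_one, map_smul, Finsupp.coe_smul, Pi.smul_apply,
      smul_eq_mul]
    rw [fderiv_mul_const hg]
    simp [mul_comm]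
  simp only [pderiv, h, mul_smul, ← Finset.smul_sum, (wedgeBasis n).sum_repr]
  rw [Algebra.algebraMap_eq_smul_one]

lemma schouten_ofVF_ofFn (V : VF n M) (f : Fn n M) (p : M) :
    schouten (ofVF V) (ofFn f) p = algebraMap ℝ _ (mvfderiv (𝓡 n) f p (V p)) := by
  have hx : localRep p (ofVF V).1 (extChartAt (𝓡 n) p p)
      = ExteriorAlgebra.ι ℝ (triv p p (V p)) := by
    unfold localRep
    rw [extChartAt_to_inv p]
    exact ExteriorAlgebra.map_apply_ι _ _
  have hy : localRep p (ofFn f).1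
      = fun w => algebraMap ℝ _ (f ((extChartAt (𝓡 n) p).symm w)) := by
    funext w
    exact AlgHom.commutes _ _
  have hd : MDifferentiableAt (𝓡 n) 𝓘(ℝ, ℝ) f p :=
    (f.contMDiff p).mdifferentiableAt (by simp)
  have hg : DifferentiableAt ℝ (fun w => f ((extChartAt (𝓡 n) p).symm w))
      (extChartAt (𝓡 n) p p) := by
    have := hd.differentiableWithinAt_writtenInExtChartAt
    rw [ModelWithCorners.range_eq_univ, differentiableWithinAt_univ] at this
    exact this
  have htriv : triv p p (V p) = V p := by
    have := (tangentBundleCore (𝓡 n) M).coordChange_self (achart _ p) p (mem_chart_source _ p) (V p)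
    rw [← TangentBundle.continuousLinearMapAt_trivializationAt_eq_core (mem_chart_source _ p)]
      at this
    exact this
  have hm : mvfderiv (𝓡 n) f p (V p)
      = fderiv ℝ (fun w => f ((extChartAt (𝓡 n) p).symm w)) (extChartAt (𝓡 n) p p)
          (triv p p (V p)) := by
    rw [htriv]
    have h1 : mfderiv (𝓡 n) 𝓘(ℝ, ℝ) f p = fderivWithin ℝ (writtenInExtChartAt (𝓡 n) 𝓘(ℝ, ℝ) p f)
        (Set.range (𝓡 n)) (extChartAt (𝓡 n) p p) := if_pos hd
    rw [ModelWithCorners.range_eq_univ, fderivWithin_univ] at h1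
    unfold mvfderiv
    rw [h1]
    rfl
  have hR : ∀ v (i : Fin n), contrR (ExteriorAlgebra.ι ℝ v) (dx i) = algebraMap ℝ _ (dx i v) :=
    fun v i => CliffordAlgebra.contractRight_ι 0 (dx i) v
  have hL : ∀ c (i : Fin n), contrL (dx i) (algebraMap ℝ _ c) = 0 :=
    fun c i => CliffordAlgebra.contractLeft_algebraMap 0 (dx i) c
  simp only [schouten, hx, hy, hR, hL, mul_zero, sub_zero, pderiv_algebraMap hg, ← map_mul,
    ← map_sum, AlgHom.commutes, hm]
  congr 1
  conv_rhs => rw [← (stdBasis n).sum_repr (triv p p (V p))]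
  simp only [dx, Module.Basis.coord_apply, map_sum, map_smul, smul_eq_mul]

lemma ιInv_algebraMap_mul {W : Type*} [AddCommGroup W] [Module ℝ W] (c : ℝ) (w : W) :
    ExteriorAlgebra.ιInv (algebraMap ℝ (ExteriorAlgebra ℝ W) c * ExteriorAlgebra.ι ℝ w) = c • w := by
  rw [← Algebra.smul_def, map_smul, ExteriorAlgebra.ι_leftInverse]

/-- The affine connection underlying a higher connection: its restriction to `A¹(M) × A¹(M)`. -/
def HigherConnection.underlying (C : HigherConnection n M) : AffineConnection n M where
  toFun V W := toVF (C.toFun (ofVF V) (ofVF W))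
  add_left V V' W := by
    have h1 : (1 : Fn n M) • ofVF V = ofVF V := Subtype.ext (funext fun p => one_smul ℝ _)
    have h2 : (1 : Fn n M) • C.toFun (ofVF V) (ofVF W) = C.toFun (ofVF V) (ofVF W) :=
      Subtype.ext (funext fun p => one_smul ℝ _)
    have h := C.linear_left 1 (ofVF V) (ofVF V') (ofVF W)
    rw [h1, h2] at h
    rw [ofVF_add, h, toVF_add]
  smul_left f V W := by
    have h0 := C.fn_left 0 (ofVF W)
    have h1 : ofFn (0 : Fn n M) = 0 := Subtype.ext (funext fun p => map_zero (algebraMap ℝ _))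
    have h := C.linear_left f (ofVF V) 0 (ofVF W)
    rw [h1] at h0
    rw [add_zero, h0, add_zero] at h
    rw [ofVF_smul, h, toVF_smul]
  add_right V W W' := by
    rw [ofVF_add, C.add_right, toVF_add]
  leibniz V f W p := by
    have h := C.leibniz 1 (ofVF V) f (ofVF W) (isHom_ofVF V) p
    rw [schouten_ofVF_ofFn] at h
    rw [ofVF_smul]
    change ExteriorAlgebra.ιInv ((C.toFun (ofVF V) (f • ofVF W)).1 p) = _
    rw [h, map_add, map_smul]
    exact congrArg (· + _) (ιInv_algebraMap_mul _ _)

variable [T2Space M]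

/-- The twist fields `F^{k,l}(X, Y) = ∇_X Y - D_X Y` for `X ∈ Aᵏ(M)` and `Y ∈ Aˡ(M)`, where `D` is
the extension of the underlying affine connection to multivector fields; `F^{k,l}` is the
restriction of this map to `Aᵏ(M) × Aˡ(M)`, and it vanishes for `k = 0` or `l = 0`. -/
def HigherConnection.twist (C : HigherConnection n M) (X Y : MVF n M) (p : M) :
    ExteriorAlgebra ℝ (TangentSpace (𝓡 n) p) :=
  (C.toFun X Y).1 p - C.underlying.induced X Y p

end Higher

end HigherConn

end

namespace HigherConn

/-! ### Interior products and degrees in the exterior algebra -/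

section Algebra

variable {W : Type*} [AddCommGroup W] [Module ℝ W]

/-! Write `D` for the underlying affine connection, extended to multivector fields. If `D` is
torsion-free, then `D_X Y - (-1)^((k-1)(l-1)) D_Y X = [X, Y]` in all degrees
(`induced_sub_induced`). Subtracting this from the definition of the higher torsion leaves `T(X, Y)
= F(X, Y) - (-1)^((k-1)(l-1)) F(Y, X)` (`torsion_eq`), so `T` vanishes exactly when `F` has the
stated symmetry. Conversely, `T = 0` on `A¹ × A¹` says that `D` is torsion-free, because there the
Schouten bracket is the Lie bracket (`schouten_ofVF`).

The extended identity is pointwise, in the chart at `p`. The sign rule `sgn_smul_contrR_mul` turns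
the second term into `∑ᵢ D_{∂ᵢ}X ∧ (dxⁱ ⌋ Y)`. The partial derivatives then give the coordinate
formula of the bracket, and the Christoffel terms cancel because `Γᵢⱼ = Γⱼᵢ`. -/

/-- The antiderivation rule for arbitrary products. It is needed because reversal, which defines the
right contraction, moves a leading vector to the end. -/
lemma contractLeft_mul (α : Module.Dual ℝ W) (b c : ExteriorAlgebra ℝ W) :
    CliffordAlgebra.contractLeft α (b * c) =
      CliffordAlgebra.contractLeft α b * c +
        CliffordAlgebra.involute b * CliffordAlgebra.contractLeft α c := by
  induction b using CliffordAlgebra.left_induction with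
  | algebraMap r =>
    rw [CliffordAlgebra.contractLeft_algebraMap_mul, CliffordAlgebra.contractLeft_algebraMap,
      zero_mul, zero_add, AlgHom.commutes]
  | add x y hx hy => simp only [add_mul, map_add, hx, hy]; abel
  | ι_mul x v hx =>
    rw [mul_assoc, CliffordAlgebra.contractLeft_ι_mul, CliffordAlgebra.contractLeft_ι_mul, hx,
      map_mul, CliffordAlgebra.involute_ι, sub_mul, smul_mul_assoc, mul_add, mul_assoc, neg_mul,
      neg_mul, mul_assoc]
    abel

/-- On `k`-vectors the two contractions differ by `(-1)^(k-1)`, the parity of the contracted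
element; `involute` records this sign without fixing a degree. -/
lemma contractRight_eq_involute (α : Module.Dual ℝ W) (x : ExteriorAlgebra ℝ W) :
    CliffordAlgebra.contractRight x α =
      CliffordAlgebra.involute (CliffordAlgebra.contractLeft α x) := by
  induction x using CliffordAlgebra.left_induction with
  | algebraMap r =>
    rw [CliffordAlgebra.contractRight_algebraMap, CliffordAlgebra.contractLeft_algebraMap, map_zero]
  | add x y hx hy => simp only [map_add, LinearMap.add_apply, hx, hy]
  | ι_mul x v hx =>
    rw [CliffordAlgebra.contractRight_eq] at hx ⊢
    rw [CliffordAlgebra.reverse.map_mul, contractLeft_mul, map_add, CliffordAlgebra.reverse.map_mul,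
      CliffordAlgebra.reverse.map_mul, hx, CliffordAlgebra.reverse_ι, CliffordAlgebra.reverse_ι,
      CliffordAlgebra.contractLeft_ι, CliffordAlgebra.reverse.commutes,
      CliffordAlgebra.reverse_involute_commute.eq, CliffordAlgebra.reverse_reverse,
      CliffordAlgebra.contractLeft_ι_mul, map_sub, map_smul, map_mul, CliffordAlgebra.involute_ι,
      ← Algebra.smul_def, neg_mul, sub_neg_eq_add, add_comm]

lemma ι_mul_eq_involute_mul (v : W) (b : ExteriorAlgebra ℝ W) :
    ExteriorAlgebra.ι ℝ v * b = CliffordAlgebra.involute b * ExteriorAlgebra.ι ℝ v := by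
  induction b using CliffordAlgebra.left_induction with
  | algebraMap r => rw [AlgHom.commutes, Algebra.commutes]
  | add x y hx hy => simp only [map_add, add_mul, mul_add, hx, hy]
  | ι_mul x w hx =>
    have h : ExteriorAlgebra.ι ℝ v * ExteriorAlgebra.ι ℝ w =
        -(ExteriorAlgebra.ι ℝ w * ExteriorAlgebra.ι ℝ v) :=
      eq_neg_of_add_eq_zero_left (ExteriorAlgebra.ι_add_mul_swap v w)
    change ExteriorAlgebra.ι ℝ v * (ExteriorAlgebra.ι ℝ w * x) = _
    rw [← mul_assoc, h, neg_mul, mul_assoc, hx, map_mul, CliffordAlgebra.involute_ι, neg_mul,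
      neg_mul, mul_assoc]

lemma involute_of_mem {k : ℕ} {x : ExteriorAlgebra ℝ W} (hx : x ∈ ⋀[ℝ]^k W) :
    CliffordAlgebra.involute x = (-1 : ℝ) ^ k • x := by
  induction hx using Submodule.pow_induction_on_left' with
  | algebraMap r => rw [AlgHom.commutes, pow_zero, one_smul]
  | add x y i _ _ hx hy => rw [map_add, hx, hy, smul_add]
  | mem_mul m hm i x _ hx =>
    obtain ⟨v, rfl⟩ := hm
    rw [map_mul, hx, mul_smul_comm, pow_succ, mul_neg_one, neg_smul, ← smul_neg, ← neg_mul]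
    exact congrArg (fun z => _ • (z * x)) (CliffordAlgebra.involute_ι v)

lemma mul_comm_of_mem {p q : ℕ} {a b : ExteriorAlgebra ℝ W} (ha : a ∈ ⋀[ℝ]^p W)
    (hb : b ∈ ⋀[ℝ]^q W) : a * b = (-1 : ℝ) ^ (p * q) • (b * a) := by
  induction ha using Submodule.pow_induction_on_left' with
  | algebraMap r => rw [zero_mul, pow_zero, one_smul, Algebra.commutes]
  | add x y i _ _ hx hy => rw [add_mul, hx, hy, mul_add, smul_add]
  | mem_mul m hm i x _ hx =>
    obtain ⟨v, rfl⟩ := hm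
    rw [mul_assoc, hx, mul_smul_comm, ← mul_assoc, ι_mul_eq_involute_mul, involute_of_mem hb,
      smul_mul_assoc, smul_mul_assoc, smul_smul, mul_assoc, ← pow_add, Nat.succ_mul]

/-- Degree 0 is treated apart, since natural-number degrees have no `⋀⁻¹`. -/
lemma contractLeft_of_mem_zero (α : Module.Dual ℝ W) {x : ExteriorAlgebra ℝ W}
    (hx : x ∈ ⋀[ℝ]^0 W) : CliffordAlgebra.contractLeft α x = 0 := by
  rw [ExteriorAlgebra.exteriorPower, pow_zero, Submodule.mem_one] at hx
  obtain ⟨r, rfl⟩ := hx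
  exact CliffordAlgebra.contractLeft_algebraMap _ _ _

lemma contractLeft_mem (α : Module.Dual ℝ W) {k : ℕ} {x : ExteriorAlgebra ℝ W}
    (hx : x ∈ ⋀[ℝ]^(k + 1) W) : CliffordAlgebra.contractLeft α x ∈ ⋀[ℝ]^k W := by
  induction k generalizing x with
  | zero =>
    rw [ExteriorAlgebra.exteriorPower, zero_add, pow_one] at hx
    obtain ⟨v, rfl⟩ := hx
    rw [ExteriorAlgebra.exteriorPower, pow_zero, Submodule.mem_one]
    exact ⟨α v, (CliffordAlgebra.contractLeft_ι _ _ _).symm⟩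
  | succ k ih =>
    rw [ExteriorAlgebra.exteriorPower, pow_succ'] at hx
    induction hx using Submodule.mul_induction_on' with
    | mem_mul_mem m hm x hx =>
      obtain ⟨v, rfl⟩ := hm
      have h : CliffordAlgebra.contractLeft α (ExteriorAlgebra.ι ℝ v * x) =
          α v • x - ExteriorAlgebra.ι ℝ v * CliffordAlgebra.contractLeft α x :=
        CliffordAlgebra.contractLeft_ι_mul _ _ _
      rw [h]
      refine sub_mem (Submodule.smul_mem _ _ hx) ?_
      rw [ExteriorAlgebra.exteriorPower, pow_succ']
      exact Submodule.mul_mem_mul ⟨v, rfl⟩ (ih hx)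
    | add x _ y _ hx hy => rw [map_add]; exact add_mem hx hy

end Algebra

lemma sgn_succ (k m : ℕ) : sgn k (m + 1) = (-1) ^ (k * m) * (-1) ^ m := by
  -- The exponent is `k * m - m`, negative when `k = 0` and `m > 0`; as `(-1)^m` is its own inverse,
  -- the integer power becomes natural powers.
  have h : ((-1 : ℝ) ^ m)⁻¹ = (-1) ^ m := by
    rw [← inv_pow, inv_neg, inv_one]
  rw [sgn, Nat.cast_add, Nat.cast_one, add_sub_cancel_right, sub_mul, one_mul,
    zpow_sub₀ (by norm_num), zpow_natCast, ← Nat.cast_mul, zpow_natCast, div_eq_mul_inv, h]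

variable {n : ℕ}

/-- Moving `v` to the front applies the involution once more, which cancels the one relating the two
contractions. This brings `Γᵢⱼ` to the left of both contracted fields. -/
lemma contrR_mul_ι (x : ExteriorAlgebra ℝ (EuclideanSpace ℝ (Fin n)))
    (α : Module.Dual ℝ (EuclideanSpace ℝ (Fin n))) (v : EuclideanSpace ℝ (Fin n)) :
    contrR x α * ExteriorAlgebra.ι ℝ v = ExteriorAlgebra.ι ℝ v * contrL α x := by
  rw [ι_mul_eq_involute_mul, contrR, contrL, contractRight_eq_involute]

/-- For `l = m + 1`, passing from right to left contraction costs `(-1)^m`, and commuting the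
resulting `m`-vector past `z` costs `(-1)^(m * k)`. Their product is `sgn k l`. For `l = 0` both
sides vanish. -/
lemma sgn_smul_contrR_mul {k l : ℕ} {y z : ExteriorAlgebra ℝ (EuclideanSpace ℝ (Fin n))}
    (hy : y ∈ ⋀[ℝ]^l (EuclideanSpace ℝ (Fin n))) (hz : z ∈ ⋀[ℝ]^k (EuclideanSpace ℝ (Fin n)))
    (α : Module.Dual ℝ (EuclideanSpace ℝ (Fin n))) :
    sgn k l • (contrR y α * z) = z * contrL α y := by
  rw [contrR, contrL, contractRight_eq_involute]
  cases l with
  | zero => rw [contractLeft_of_mem_zero α hy, map_zero, zero_mul, mul_zero, smul_zero]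
  | succ m =>
    have hc := contractLeft_mem α hy
    rw [involute_of_mem hc, smul_mul_assoc, mul_comm_of_mem hc hz, smul_smul, smul_smul, sgn_succ,
      mul_comm m k]
    have h (j : ℕ) : (-1 : ℝ) ^ j * (-1) ^ j = 1 := by rw [← mul_pow]; norm_num
    rw [show (-1 : ℝ) ^ (k * m) * (-1) ^ m * (-1) ^ m * (-1) ^ (k * m) =
      ((-1) ^ (k * m) * (-1) ^ (k * m)) * ((-1) ^ m * (-1) ^ m) by ring, h, h, one_mul, one_smul]

/-! ### Partial derivatives -/

lemma wedgeBasis_mem (J : Finset (Fin n)) :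
    wedgeBasis n J ∈ ⋀[ℝ]^J.card (EuclideanSpace ℝ (Fin n)) := by
  rw [wedgeBasis, ExteriorAlgebra.basis_apply]
  exact ExteriorAlgebra.ιMulti_range ℝ _ ⟨_, rfl⟩

lemma wedgeBasis_repr_eq_zero {k : ℕ} {x : ExteriorAlgebra ℝ (EuclideanSpace ℝ (Fin n))}
    (hx : x ∈ ⋀[ℝ]^k (EuclideanSpace ℝ (Fin n))) {J : Finset (Fin n)} (hJ : J.card ≠ k) :
    (wedgeBasis n).repr x J = 0 := by
  let A : ℕ → Submodule ℝ (ExteriorAlgebra ℝ (EuclideanSpace ℝ (Fin n))) := fun i => ⋀[ℝ]^i _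
  -- Composing with the projection to degree `k` gives a linear map that can be tested on the basis,
  -- whose elements are homogeneous.
  have h : (wedgeBasis n).coord J ∘ₗ GradedAlgebra.proj A k = 0 := (wedgeBasis n).ext fun K => by
    rw [LinearMap.comp_apply, GradedAlgebra.proj_apply, LinearMap.zero_apply]
    by_cases hK : K.card = k
    · rw [DirectSum.decompose_of_mem_same A (hK ▸ wedgeBasis_mem K), Module.Basis.coord_apply,
        Module.Basis.repr_self, Finsupp.single_eq_of_ne]
      rintro rfl
      exact hJ hK
    · rw [DirectSum.decompose_of_mem_ne A (wedgeBasis_mem K) hK, map_zero]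
  have hx' := LinearMap.congr_fun h x
  rwa [LinearMap.comp_apply, GradedAlgebra.proj_apply, DirectSum.decompose_of_mem_same A hx] at hx'

/-- Components outside degree `k` vanish identically, so their derivatives vanish; no
differentiability of `f` is involved. -/
lemma pderiv_mem {k : ℕ} {f : EuclideanSpace ℝ (Fin n) → ExteriorAlgebra ℝ (EuclideanSpace ℝ (Fin n))}
    (hf : ∀ u, f u ∈ ⋀[ℝ]^k (EuclideanSpace ℝ (Fin n))) (i : Fin n)
    (u : EuclideanSpace ℝ (Fin n)) : pderiv i f u ∈ ⋀[ℝ]^k (EuclideanSpace ℝ (Fin n)) := by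
  refine Submodule.sum_mem _ fun J _ => ?_
  by_cases hJ : J.card = k
  · exact Submodule.smul_mem _ _ (hJ ▸ wedgeBasis_mem J)
  · simp only [wedgeBasis_repr_eq_zero (hf _) hJ, fderiv_fun_const, Pi.zero_apply,
      zero_apply, zero_smul, zero_mem]

lemma pderiv_ι {i : Fin n} {g : EuclideanSpace ℝ (Fin n) → EuclideanSpace ℝ (Fin n)}
    {u : EuclideanSpace ℝ (Fin n)} (hg : DifferentiableAt ℝ g u) :
    pderiv i (fun w => ExteriorAlgebra.ι ℝ (g w)) u =
      ExteriorAlgebra.ι ℝ (fderiv ℝ g u (stdBasis n i)) := by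
  have h (J : Finset (Fin n)) :
      fderiv ℝ (fun w => (wedgeBasis n).repr (ExteriorAlgebra.ι ℝ (g w)) J) u (stdBasis n i) =
        (wedgeBasis n).repr (ExteriorAlgebra.ι ℝ (fderiv ℝ g u (stdBasis n i))) J := by
    let L : EuclideanSpace ℝ (Fin n) →L[ℝ] ℝ :=
      (((wedgeBasis n).coord J) ∘ₗ (ExteriorAlgebra.ι ℝ)).toContinuousLinearMap
    have h := (L.hasFDerivAt.comp u hg.hasFDerivAt).fderiv
    exact congrArg (fun T => T (stdBasis n i)) h
  simp only [pderiv, h, (wedgeBasis n).sum_repr]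

lemma map_mem {V W : Type*} [AddCommGroup V] [Module ℝ V] [AddCommGroup W] [Module ℝ W]
    (f : V →ₗ[ℝ] W) {k : ℕ} {x : ExteriorAlgebra ℝ V} (hx : x ∈ ⋀[ℝ]^k V) :
    ExteriorAlgebra.map f x ∈ ⋀[ℝ]^k W := by
  induction hx using Submodule.pow_induction_on_left' with
  | algebraMap r =>
    rw [AlgHom.commutes, ExteriorAlgebra.exteriorPower, pow_zero, Submodule.mem_one]
    exact ⟨r, rfl⟩
  | add x y i _ _ hx hy => rw [map_add]; exact add_mem hx hy
  | mem_mul m hm i x _ hx =>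
    obtain ⟨v, rfl⟩ := hm
    rw [map_mul, ExteriorAlgebra.map_apply_ι, ExteriorAlgebra.exteriorPower, pow_succ']
    exact Submodule.mul_mem_mul ⟨_, rfl⟩ hx

/-! ### Vector fields in charts -/

section Charts

variable {n : ℕ} {M : Type*} [TopologicalSpace M] [ChartedSpace (EuclideanSpace ℝ (Fin n)) M]
  [IsManifold (𝓡 n) ∞ M]

/-- The fibre of `TM` at `p` is modelled on `ℝⁿ` through the preferred chart at `p`, so at `p`
itself the trivialisation is the identity. -/
lemma triv_self (p : M) (v : TangentSpace (𝓡 n) p) : triv p p v = v := by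
  have := (tangentBundleCore (𝓡 n) M).coordChange_self (achart _ p) p (mem_chart_source _ p) v
  rwa [← TangentBundle.continuousLinearMapAt_trivializationAt_eq_core (mem_chart_source _ p)]
    at this

lemma triv_trivSymm {p q : M} (hq : q ∈ (chartAt (EuclideanSpace ℝ (Fin n)) p).source)
    (v : EuclideanSpace ℝ (Fin n)) : triv p q (trivSymm p q v) = v := by
  have hq' : q ∈ (trivializationAt (EuclideanSpace ℝ (Fin n))
      (TangentSpace (𝓡 n) : M → Type _) p).baseSet := hq
  exact Trivialization.continuousLinearMapAt_symmL _ hq' v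

lemma trivSymm_self (p : M) (v : EuclideanSpace ℝ (Fin n)) :
    trivSymm p p v = (v : TangentSpace (𝓡 n) p) := by
  have h := triv_trivSymm (mem_chart_source _ p) v
  rwa [triv_self] at h

/-- The representation of a vector field in the preferred chart at `p`. -/
noncomputable def localVF (p : M) (V : VF n M) (u : EuclideanSpace ℝ (Fin n)) : EuclideanSpace ℝ (Fin n) :=
  triv p ((extChartAt (𝓡 n) p).symm u) (V ((extChartAt (𝓡 n) p).symm u))

lemma localRep_ofVF (p : M) (V : VF n M) :
    localRep p (ofVF V).1 = fun u => ExteriorAlgebra.ι ℝ (localVF p V u) :=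
  funext fun _ => ExteriorAlgebra.map_apply_ι _ _

lemma differentiableAt_localVF (p : M) (V : VF n M) :
    DifferentiableAt ℝ (localVF p V) (extChartAt (𝓡 n) p p) := by
  have h := ((contMDiffAt_triv V p).mdifferentiableAt
    (by simp)).differentiableWithinAt_writtenInExtChartAt
  rw [ModelWithCorners.range_eq_univ, differentiableWithinAt_univ] at h
  exact h

/-- `mlieBracket` pulls fields back by the inverse of the differential of the inverse chart. On the
chart target that inverse is the differential of the chart, which is `triv`. Equality near the base
point suffices, as the bracket depends only on germs. -/
lemma mpullbackWithin_eventuallyEq_localVF (p : M) (V : VF n M) :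
    VectorField.mpullbackWithin 𝓘(ℝ, EuclideanSpace ℝ (Fin n)) (𝓡 n) (extChartAt (𝓡 n) p).symm
      (⇑V) (Set.range (𝓡 n)) =ᶠ[𝓝 (extChartAt (𝓡 n) p p)] localVF p V := by
  filter_upwards [extChartAt_target_mem_nhds p] with u hu
  have hs : (extChartAt (𝓡 n) p).symm u ∈ (chartAt (EuclideanSpace ℝ (Fin n)) p).source := by
    rw [← extChartAt_source (𝓡 n)]
    exact (extChartAt (𝓡 n) p).map_target hu
  have h := TangentBundle.continuousLinearMapAt_trivializationAt (I := 𝓡 n) hs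
  rw [VectorField.mpullbackWithin_apply, localVF, triv, h,
    ContinuousLinearMap.inverse_eq
      (mfderivWithin_extChartAt_symm_comp_mfderiv_extChartAt hu)
      (mfderiv_extChartAt_comp_mfderivWithin_extChartAt_symm hu)]
  rfl

lemma mlieBracket_eq_localVF (p : M) (V W : VF n M) :
    VectorField.mlieBracket (𝓡 n) (⇑V) (⇑W) p =
      (VectorField.lieBracket ℝ (localVF p V) (localVF p W) (extChartAt (𝓡 n) p p) :
        EuclideanSpace ℝ (Fin n)) := by
  rw [← VectorField.mlieBracketWithin_univ, VectorField.mlieBracketWithin_apply,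
    mfderiv_extChartAt_self]
  refine (congrArg (fun T : EuclideanSpace ℝ (Fin n) →L[ℝ] EuclideanSpace ℝ (Fin n) => T _)
    ContinuousLinearMap.inverse_id).trans ?_
  refine ((mpullbackWithin_eventuallyEq_localVF p V).lieBracketWithin_vectorField_eq_nhds
    (mpullbackWithin_eventuallyEq_localVF p W)).trans ?_
  rw [Set.preimage_univ, Set.univ_inter, ModelWithCorners.range_eq_univ,
    VectorField.lieBracketWithin_univ]

/-- Contractions of vectors are the scalars `dxⁱ(v)`, and summing over `i` reassembles the
directional derivatives `DW(V) - DV(W)`. -/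
lemma schouten_ofVF (V W : VF n M) (p : M) :
    schouten (ofVF V) (ofVF W) p =
      ExteriorAlgebra.ι ℝ (VectorField.mlieBracket (𝓡 n) (⇑V) (⇑W) p) := by
  have hR : ∀ v (i : Fin n), contrR (ExteriorAlgebra.ι ℝ v) (dx i) = algebraMap ℝ _ (dx i v) :=
    fun v i => CliffordAlgebra.contractRight_ι 0 (dx i) v
  have hL : ∀ v (i : Fin n), contrL (dx i) (ExteriorAlgebra.ι ℝ v) = algebraMap ℝ _ (dx i v) :=
    fun v i => CliffordAlgebra.contractLeft_ι 0 (dx i) v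
  have hs : ∀ v, ∑ i, dx i v • stdBasis n i = v := (stdBasis n).sum_repr
  rw [mlieBracket_eq_localVF, VectorField.lieBracket_eq]
  simp only [schouten, localRep_ofVF, hR, hL, pderiv_ι (differentiableAt_localVF p _),
    ← Algebra.commutes, ← Algebra.smul_def, ← map_smul, ← map_sub, ← map_sum,
    Finset.sum_sub_distrib, hs, ExteriorAlgebra.map_apply_ι, trivSymm_self]

lemma localRep_mem {k : ℕ} {X : MVF n M} (hX : IsHom k X) (p : M) (u : EuclideanSpace ℝ (Fin n)) :
    localRep p X.1 u ∈ ⋀[ℝ]^k (EuclideanSpace ℝ (Fin n)) :=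
  map_mem _ (hX _)

lemma HigherConnection.TorsionFree.underlying {C : HigherConnection n M} (hC : C.TorsionFree) :
    C.underlying.TorsionFree := by
  intro V W p
  have h := congrArg ExteriorAlgebra.ιInv
    (hC 1 1 (ofVF V) (ofVF W) (isHom_ofVF V) (isHom_ofVF W) p)
  have hs : sgn 1 1 = 1 := by simp [sgn]
  rw [HigherConnection.torsion, schouten_ofVF, hs, one_smul, map_sub, map_sub, map_zero,
    ExteriorAlgebra.ι_leftInverse] at h
  exact h

/-! ### Symmetry of the Christoffel symbols and the reduction of torsion to twist fields. -/

variable [T2Space M]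

/-- The bump function that makes the coordinate field global equals 1 near `p`. -/
lemma localVF_coordVF_eventuallyEq (p : M) (i : Fin n) :
    localVF p (coordVF p i) =ᶠ[𝓝 (extChartAt (𝓡 n) p p)] fun _ => stdBasis n i := by
  let f : SmoothBumpFunction (𝓡 n) p := Classical.arbitrary _
  have hc : Filter.Tendsto (extChartAt (𝓡 n) p).symm (𝓝 (extChartAt (𝓡 n) p p)) (𝓝 p) := by
    have h := continuousAt_extChartAt_symm (I := 𝓡 n) p
    rwa [ContinuousAt, extChartAt_to_inv] at h
  filter_upwards [extChartAt_target_mem_nhds p, hc.eventually f.eventuallyEq_one] with u hu hf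
  have hs : (extChartAt (𝓡 n) p).symm u ∈ (chartAt (EuclideanSpace ℝ (Fin n)) p).source := by
    rw [← extChartAt_source (𝓡 n)]
    exact (extChartAt (𝓡 n) p).map_target hu
  change triv p _ (f ((extChartAt (𝓡 n) p).symm u) • trivSymm p _ (stdBasis n i)) = _
  rw [hf, map_smul, triv_trivSymm hs]
  exact one_smul ℝ _

lemma mlieBracket_coordVF (p : M) (i j : Fin n) :
    VectorField.mlieBracket (𝓡 n) (⇑(coordVF p i)) (⇑(coordVF p j)) p = 0 := by
  rw [mlieBracket_eq_localVF, (localVF_coordVF_eventuallyEq p i).lieBracket_vectorField_eq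
    (localVF_coordVF_eventuallyEq p j), VectorField.lieBracket_eq]
  simp only [fderiv_fun_const, Pi.zero_apply, zero_apply, sub_zero]
  rfl

lemma AffineConnection.TorsionFree.christoffel_comm {D : AffineConnection n M} (hD : D.TorsionFree)
    (p : M) (i j : Fin n) : christoffel D p i j = christoffel D p j i := by
  have h := hD (coordVF p i) (coordVF p j) p
  rw [mlieBracket_coordVF, sub_zero, sub_eq_zero] at h
  rw [christoffel, christoffel, h]

lemma AffineConnection.TorsionFree.induced_sub_induced {D : AffineConnection n M}
    (hD : D.TorsionFree) {k l : ℕ} {X Y : MVF n M} (hX : IsHom k X) (hY : IsHom l Y) (p : M) :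
    D.induced X Y p - sgn k l • D.induced Y X p = schouten X Y p := by
  have hx := localRep_mem hX p
  have hy := localRep_mem hY p (extChartAt (𝓡 n) p p)
  -- `D_{∂ᵢ}` preserves degree: contraction lowers it by one and the wedge with `Γᵢⱼ` restores it.
  -- The sign rule requires this.
  have hcov (i : Fin n) : covDeriv D X p i ∈ ⋀[ℝ]^k (EuclideanSpace ℝ (Fin n)) := by
    refine add_mem (pderiv_mem hx i _) (Submodule.sum_mem _ fun j _ => ?_)
    cases k with
    | zero =>
      rw [contrL, contractLeft_of_mem_zero _ (hx _), mul_zero]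
      exact zero_mem _
    | succ k =>
      rw [ExteriorAlgebra.exteriorPower, pow_succ']
      exact Submodule.mul_mem_mul ⟨_, rfl⟩ (contractLeft_mem _ (hx _))
  simp only [AffineConnection.induced, schouten, ← map_smul, ← map_sub, Finset.smul_sum,
    sgn_smul_contrR_mul hy (hcov _)]
  congr 1
  simp only [covDeriv, mul_add, add_mul, Finset.mul_sum, Finset.sum_mul, Finset.sum_add_distrib,
    Finset.sum_sub_distrib, ← mul_assoc, contrR_mul_ι]
  -- The only use of vanishing torsion: exchanging the summation indices and using `Γᵢⱼ = Γⱼᵢ`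
  -- identifies the Christoffel parts of the two terms.
  have hswap : ∑ i, ∑ j, ExteriorAlgebra.ι ℝ (christoffel D p i j) *
        contrL (dx i) (localRep p X.1 (extChartAt (𝓡 n) p p)) *
        contrL (dx j) (localRep p Y.1 (extChartAt (𝓡 n) p p)) =
      ∑ i, ∑ j, ExteriorAlgebra.ι ℝ (christoffel D p i j) *
        contrL (dx j) (localRep p X.1 (extChartAt (𝓡 n) p p)) *
        contrL (dx i) (localRep p Y.1 (extChartAt (𝓡 n) p p)) := by
    rw [Finset.sum_comm]
    simp only [hD.christoffel_comm p]
  rw [hswap]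
  abel

lemma HigherConnection.torsion_eq (C : HigherConnection n M) (hC : C.underlying.TorsionFree)
    {k l : ℕ} {X Y : MVF n M} (hX : IsHom k X) (hY : IsHom l Y) (p : M) :
    C.torsion k l X Y p = C.twist X Y p - sgn k l • C.twist Y X p := by
  rw [HigherConnection.torsion, HigherConnection.twist, HigherConnection.twist,
    ← hC.induced_sub_induced hX hY, smul_sub]
  abel

end Charts

end HigherConn

theorem mainTheorem4 (n : ℕ) (M : Type*) [TopologicalSpace M] [T2Space M]
    [ChartedSpace (EuclideanSpace ℝ (Fin n)) M] [IsManifold (𝓡 n) ∞ M]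
    (C : HigherConn.HigherConnection n M) :
    C.TorsionFree ↔
      C.underlying.TorsionFree ∧
      ∀ (k l : ℕ) (X Y : HigherConn.MVF n M), HigherConn.IsHom k X → HigherConn.IsHom l Y →
        ∀ p, C.twist X Y p = HigherConn.sgn k l • C.twist Y X p := by
  constructor
  · intro h
    refine ⟨h.underlying, fun k l X Y hX hY p => ?_⟩
    rw [← sub_eq_zero, ← C.torsion_eq h.underlying hX hY]
    exact h k l X Y hX hY p
  · rintro ⟨h, hF⟩ k l X Y hX hY p
    rw [C.torsion_eq h hX hY, hF k l X Y hX hY p, sub_self]
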